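/- An MV-algebra is a structure $(A,\oplus,\neg,0)$ such that $(A,\oplus,0)$ is a commutative monoid and $\neg\neg x=x$, $x\oplus\neg 0=\neg 0$, $\neg(\neg x\oplus y)\oplus y=\neg(\neg y\oplus x)\oplus x$. Put $u=\neg 0$, $x\ominus y=\neg(\neg x\oplus y)$, $x\odot y=\neg(\neg x\oplus\neg y)$, $x\wedge y=x\ominus(x\ominus y)$, and $x\le y$ iff $x\ominus y=0$. A $PMV_f$-algebra is an MV-algebra with an associative and commutative product such that, for all $a,b,c$: $a0=0$, $a(b\oplus c)\le ab\oplus ac$, $ab\ominus ac\le a(b\ominus c)$, $ab\le a\wedge b$ and $a(b\ominus c)=ab\ominus ac$. Let $A$ be a $PMV_f$-algebra. An ideal of $A$ is a non-empty down-closed subset that is closed under $\oplus$; $\operatorname{Spec}A$ is the set of proper ideals $P$ such that $a\wedge b\in P$ implies $a\in P$ or $b\in P$. For $P\in\operatorname{Spec}A$, the quotient $A/P$ by the congruence $x\equiv y\iff (x\ominus y)\oplus(y\ominus x)\in P$ is a non-trivial totally ordered $PMV_f$-algebra. For a non-trivial totally ordered $PMV_f$-algebra $C$, let $C^\sharp$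 be the set $\mathbb Z\times C$ with $(m,u)$ and $(m+1,0)$ identified, with the lexicographic order (on the representatives $(m,a)$ with $a\ne u$), zero $(0,0)$, $-(m,a)=(-m-1,\neg a)$, $(m,a)+(n,b)=(m+n,a\oplus b)$ if $a\oplus b\neq u$ and $(m,a)+(n,b)=(m+n+1,a\odot b)$ if $a\oplus b=u$, and the product $$(m,a)(n,b)=mn(0,u^2)+m(0,bu)+n(0,au)+(0,ab).$$ Let $A^\sharp$ be the subset of $\prod_{P\in\operatorname{Spec}A}(A/P)^\sharp$ (with pointwise operations and order) generated, under $0,+,-,\cdot,\vee,\wedge$, by the elements $(0,\widehat a)=((0,[a]_P))_P$, $a\in A$, and let $\mathbf u=(0,\widehat u)$. Then $A^\sharp$, with the operations and order of the product, is a semi-low $f$-ring with strong unit $\mathbf u$. That is, $A^\sharp$ is a commutative (not necessarily unital) ring and a lattice, with $x\le y\Rightarrow z+x\le z+y$ and $x,y\ge 0\Rightarrow xy\ge 0$; $\mathbf u\ge 0$, and for every $x\in A^\sharp$ there is an integer $n\ge 0$ with $|x|\le n\mathbf u$; $ab\le a\wedge b$ whenever $0\le a,b\le\mathbf u$; and if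 $a\wedge b=0$ and $c\ge 0$, then $ac\wedge b=a\wedge cb=0$. -/

import Mathlib

/-- An MV-algebra `(A, ⊕, ¬, 0)`.  The commutative monoid operation `⊕` is written `+`;
the negation is `mvNeg`. -/
class MVAlgebra (A : Type*) extends AddCommMonoid A where
  mvNeg : A → A
  mvNeg_mvNeg : ∀ x : A, mvNeg (mvNeg x) = x
  add_mvNeg_zero : ∀ x : A, x + mvNeg 0 = mvNeg 0
  mv_comm : ∀ x y : A, mvNeg (mvNeg x + y) + y = mvNeg (mvNeg y + x) + x

namespace MVAlgebra

variable {A : Type*} [MVAlgebra A]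

/-- The top element `u = ¬ 0`. -/
def top (A : Type*) [MVAlgebra A] : A := mvNeg 0

/-- Truncated difference `x ⊖ y = ¬ (¬ x ⊕ y)`. -/
def tsub (x y : A) : A := mvNeg (mvNeg x + y)

/-- `x ⊙ y = ¬ (¬ x ⊕ ¬ y)`. -/
def odot (x y : A) : A := mvNeg (mvNeg x + mvNeg y)

/-- The order: `x ≤ y` iff `x ⊖ y = 0`. -/
def Le (x y : A) : Prop := tsub x y = 0

/-- The infimum `x ∧ y = x ⊖ (x ⊖ y)`. -/
def inf (x y : A) : A := tsub x (tsub x y)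

theorem neg_top : mvNeg (top A) = 0 := mvNeg_mvNeg 0

theorem add_top (x : A) : x + top A = top A := add_mvNeg_zero x

theorem neg_add_self (x : A) : mvNeg x + x = top A := by
  have h := mv_comm x (top A)
  rw [add_top, neg_top, zero_add] at h
  exact h.symm

theorem le_iff (x y : A) : Le x y ↔ mvNeg x + y = top A := by
  unfold Le tsub
  constructor
  · intro h
    rw [← mvNeg_mvNeg (mvNeg x + y), h]; rfl
  · intro h
    rw [h, neg_top]

theorem le_iff_exists (x y : A) : Le x y ↔ ∃ z, x + z = y := by
  constructor
  · intro h
    have h2 := mv_comm x y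
    change tsub x y + y = tsub y x + x at h2
    rw [show tsub x y = 0 from h, zero_add] at h2
    exact ⟨tsub y x, by rw [add_comm]; exact h2.symm⟩
  · rintro ⟨z, rfl⟩
    rw [le_iff, ← add_assoc, neg_add_self, add_comm, add_top]

theorem le_trans' {x y z : A} (h : Le x y) (h' : Le y z) : Le x z := by
  rw [le_iff_exists] at *
  obtain ⟨a, rfl⟩ := h
  obtain ⟨b, rfl⟩ := h'
  exact ⟨a + b, by rw [add_assoc]⟩

theorem le_add_right' (x y : A) : Le x (x + y) := (le_iff_exists _ _).2 ⟨y, rfl⟩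

theorem add_le_add' {x y z w : A} (h : Le x y) (h' : Le z w) : Le (x + z) (y + w) := by
  rw [le_iff_exists] at *
  obtain ⟨a, rfl⟩ := h
  obtain ⟨b, rfl⟩ := h'
  exact ⟨a + b, by rw [add_add_add_comm]⟩

theorem tsub_le_iff (x z w : A) : Le (tsub x z) w ↔ Le x (z + w) := by
  rw [le_iff, le_iff, tsub, mvNeg_mvNeg, add_assoc]

theorem le_refl' (x : A) : Le x x := (le_iff_exists _ _).2 ⟨0, add_zero x⟩

theorem le_add_tsub (x y : A) : Le x (y + tsub x y) := (tsub_le_iff x y _).1 (le_refl' _)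

theorem tsub_self (x : A) : tsub x x = 0 := by
  rw [tsub, neg_add_self, neg_top]

theorem tsub_triangle (x y z : A) : Le (tsub x z) (tsub x y + tsub y z) := by
  rw [tsub_le_iff]
  have h := le_trans' (le_add_tsub x y) (add_le_add' (le_add_tsub y z) (le_refl' (tsub x y)))
  rwa [add_assoc, add_comm (tsub y z)] at h

theorem tsub_add_le (x y z w : A) : Le (tsub (x + z) (y + w)) (tsub x y + tsub z w) := by
  rw [tsub_le_iff, add_add_add_comm]
  exact add_le_add' (le_add_tsub x y) (le_add_tsub z w)

theorem neg_tsub_neg (x y : A) : tsub (mvNeg x) (mvNeg y) = tsub y x := by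
  rw [tsub, tsub, mvNeg_mvNeg, add_comm]

theorem inf_le_left' (x y : A) : Le (inf x y) x := by
  rw [inf, tsub_le_iff, add_comm]
  exact le_add_right' x _

theorem zero_ne_top [Nontrivial A] : (0 : A) ≠ top A := by
  intro h
  have key : ∀ x : A, x = 0 := fun x => by
    have h2 := add_top x
    rwa [← h, add_zero] at h2
  obtain ⟨x, y, hxy⟩ := exists_pair_ne A
  exact hxy ((key x).trans (key y).symm)

end MVAlgebra

open MVAlgebra in
/-- A (commutative) MVW-rig: an MV-algebra with an associative commutative product such that
`a 0 = 0`, `a (b ⊕ c) ≤ a b ⊕ a c` and `a b ⊖ a c ≤ a (b ⊖ c)`. -/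
class MVWRig (A : Type*) extends MVAlgebra A, CommSemigroup A where
  mul_zero' : ∀ a : A, a * 0 = 0
  mul_add_le : ∀ a b c : A, tsub (a * (b + c)) (a * b + a * c) = 0
  tsub_mul_le : ∀ a b c : A, tsub (tsub (a * b) (a * c)) (a * tsub b c) = 0

open MVAlgebra in
/-- A PMV_f-algebra: an MVW-rig with `a b ≤ a ∧ b` and `a (b ⊖ c) = a b ⊖ a c`. -/
class PMVf (A : Type*) extends MVWRig A where
  mul_le_inf : ∀ a b : A, Le (a * b) (inf a b)
  mul_tsub : ∀ a b c : A, a * tsub b c = tsub (a * b) (a * c)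

theorem PMVf.mul_le_left' {A : Type*} [PMVf A] (a b : A) : MVAlgebra.Le (a * b) a :=
  MVAlgebra.le_trans' (PMVf.mul_le_inf a b) (MVAlgebra.inf_le_left' a b)

open MVAlgebra in
/-- Ideals of (the underlying MV-algebra of) `A`. -/
structure MVIdeal (A : Type*) [MVAlgebra A] where
  carrier : Set A
  nonempty : carrier.Nonempty
  down : ∀ {a b : A}, Le a b → b ∈ carrier → a ∈ carrier
  add_mem : ∀ {a b : A}, a ∈ carrier → b ∈ carrier → a + b ∈ carrier

open MVAlgebra in
/-- `Spec A`: the (proper) prime ideals of the underlying MV-algebra of `A`. -/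
structure MVSpec (A : Type*) [MVAlgebra A] extends MVIdeal A where
  proper : carrier ≠ Set.univ
  prime : ∀ a b : A, inf a b ∈ carrier → a ∈ carrier ∨ b ∈ carrier

namespace MVIdeal

open MVAlgebra

section

variable {A : Type*} [MVAlgebra A] (I : MVIdeal A)

theorem zero_mem : (0 : A) ∈ I.carrier := by
  obtain ⟨x, hx⟩ := I.nonempty
  exact I.down ((le_iff_exists _ _).2 ⟨x, zero_add x⟩) hx

/-- The relation `x ≡ y` iff `(x ⊖ y) ⊕ (y ⊖ x) ∈ I`. -/
def Rel (x y : A) : Prop := tsub x y + tsub y x ∈ I.carrier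

theorem rel_iff (x y : A) : I.Rel x y ↔ tsub x y ∈ I.carrier ∧ tsub y x ∈ I.carrier := by
  constructor
  · intro h
    refine ⟨I.down (le_add_right' _ _) h, I.down ?_ h⟩
    rw [add_comm]
    exact le_add_right' _ _
  · rintro ⟨h, h'⟩
    exact I.add_mem h h'

theorem rel_refl (x : A) : I.Rel x x := by
  rw [rel_iff, MVAlgebra.tsub_self]
  exact ⟨I.zero_mem, I.zero_mem⟩

theorem rel_symm {x y : A} (h : I.Rel x y) : I.Rel y x := by
  rw [rel_iff] at *
  exact h.symm

theorem rel_trans {x y z : A} (h : I.Rel x y) (h' : I.Rel y z) : I.Rel x z := by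
  rw [rel_iff] at *
  exact ⟨I.down (tsub_triangle x y z) (I.add_mem h.1 h'.1),
    I.down (tsub_triangle z y x) (I.add_mem h'.2 h.2)⟩

def setoid : Setoid A := ⟨I.Rel, I.rel_refl, I.rel_symm, I.rel_trans⟩

/-- The quotient `A / I`. -/
def Quo : Type _ := Quotient I.setoid

/-- The class `[a]_I`. -/
def cls (a : A) : I.Quo := Quotient.mk I.setoid a

theorem rel_add {x y z w : A} (h : I.Rel x y) (h' : I.Rel z w) : I.Rel (x + z) (y + w) := by
  rw [rel_iff] at *
  exact ⟨I.down (tsub_add_le x y z w) (I.add_mem h.1 h'.1),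
    I.down (tsub_add_le y x w z) (I.add_mem h.2 h'.2)⟩

theorem rel_neg {x y : A} (h : I.Rel x y) : I.Rel (mvNeg x) (mvNeg y) := by
  rw [rel_iff] at *
  rw [neg_tsub_neg, neg_tsub_neg]
  exact h.symm

end

variable {A : Type*} [PMVf A] (I : MVIdeal A)

theorem rel_mul_left (a : A) {x y : A} (h : I.Rel x y) : I.Rel (a * x) (a * y) := by
  rw [rel_iff] at *
  rw [← PMVf.mul_tsub, ← PMVf.mul_tsub, mul_comm a, mul_comm a]
  exact ⟨I.down (PMVf.mul_le_left' _ _) h.1, I.down (PMVf.mul_le_left' _ _) h.2⟩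

theorem rel_mul {x y z w : A} (h : I.Rel x y) (h' : I.Rel z w) : I.Rel (x * z) (y * w) := by
  refine I.rel_trans (I.rel_mul_left x h') ?_
  rw [mul_comm x, mul_comm y]
  exact I.rel_mul_left w h

instance : Zero I.Quo := ⟨I.cls 0⟩

instance : Add I.Quo := ⟨Quotient.map₂ (sa := I.setoid) (sb := I.setoid) (sc := I.setoid)
  (· + ·) fun _ _ h _ _ h' => I.rel_add h h'⟩

instance : Mul I.Quo := ⟨Quotient.map₂ (sa := I.setoid) (sb := I.setoid) (sc := I.setoid)
  (· * ·) fun _ _ h _ _ h' => I.rel_mul h h'⟩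

/-- `A / I` with `[a] ⊕ [b] = [a ⊕ b]`, `¬ [a] = [¬ a]`, `[a] [b] = [a b]`. -/
instance : PMVf I.Quo where
  mvNeg := Quotient.map (sa := I.setoid) (sb := I.setoid) mvNeg fun _ _ h => I.rel_neg h
  nsmul := nsmulRec
  add_assoc := by
    rintro ⟨a⟩ ⟨b⟩ ⟨c⟩; exact congrArg I.cls (add_assoc a b c)
  zero_add := by
    rintro ⟨a⟩; exact congrArg I.cls (zero_add a)
  add_zero := by
    rintro ⟨a⟩; exact congrArg I.cls (add_zero a)
  add_comm := by
    rintro ⟨a⟩ ⟨b⟩; exact congrArg I.cls (add_comm a b)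
  mul_assoc := by
    rintro ⟨a⟩ ⟨b⟩ ⟨c⟩; exact congrArg I.cls (mul_assoc a b c)
  mul_comm := by
    rintro ⟨a⟩ ⟨b⟩; exact congrArg I.cls (mul_comm a b)
  mvNeg_mvNeg := by
    rintro ⟨a⟩; exact congrArg I.cls (mvNeg_mvNeg a)
  add_mvNeg_zero := by
    rintro ⟨a⟩; exact congrArg I.cls (add_mvNeg_zero a)
  mv_comm := by
    rintro ⟨a⟩ ⟨b⟩; exact congrArg I.cls (mv_comm a b)
  mul_zero' := by
    rintro ⟨a⟩; exact congrArg I.cls (MVWRig.mul_zero' a)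
  mul_add_le := by
    rintro ⟨a⟩ ⟨b⟩ ⟨c⟩; exact congrArg I.cls (MVWRig.mul_add_le a b c)
  tsub_mul_le := by
    rintro ⟨a⟩ ⟨b⟩ ⟨c⟩; exact congrArg I.cls (MVWRig.tsub_mul_le a b c)
  mul_le_inf := by
    rintro ⟨a⟩ ⟨b⟩; exact congrArg I.cls (PMVf.mul_le_inf a b)
  mul_tsub := by
    rintro ⟨a⟩ ⟨b⟩ ⟨c⟩; exact congrArg I.cls (PMVf.mul_tsub a b c)

end MVIdeal

instance {A : Type*} [PMVf A] (P : MVSpec A) : Nontrivial P.toMVIdeal.Quo := by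
  obtain ⟨a, ha⟩ := (Set.ne_univ_iff_exists_notMem _).1 P.proper
  refine ⟨P.cls a, P.cls 0, fun h => ha ?_⟩
  have h1 := ((P.rel_iff a 0).1 (Quotient.exact h)).1
  rwa [MVAlgebra.tsub, add_zero, MVAlgebra.mvNeg_mvNeg] at h1

/-- The underlying set of the ring of a nontrivial PMV_f-chain `C`: pairs `(m, a)` in `ℤ × C`,
where `(m, u)` and `(m + 1, 0)` are the same element; each element is represented
by its unique pair with `a ≠ u`. -/
structure ChainSharp (C : Type*) [PMVf C] where
  int : ℤ
  val : C
  ne_top : val ≠ MVAlgebra.top C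

namespace ChainSharp

open MVAlgebra

variable {C : Type*} [PMVf C] [Nontrivial C]

open Classical in
/-- The element denoted by an arbitrary pair `(m, a)`, with `(m, u) = (m + 1, 0)`. -/
noncomputable def pair (m : ℤ) (a : C) : ChainSharp C :=
  if h : a = top C then ⟨m + 1, 0, zero_ne_top⟩ else ⟨m, a, h⟩

noncomputable instance : Zero (ChainSharp C) := ⟨pair 0 0⟩

open Classical in
/-- `(m, a) + (n, b)` is `(m + n, a ⊕ b)` if `a ⊕ b ≠ u`
and `(m + n + 1, a ⊙ b)` if `a ⊕ b = u`. -/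
noncomputable instance : Add (ChainSharp C) :=
  ⟨fun x y => if x.val + y.val = top C then pair (x.int + y.int + 1) (odot x.val y.val)
    else pair (x.int + y.int) (x.val + y.val)⟩

/-- `-(m, a) = (-m - 1, ¬ a)`. -/
noncomputable instance : Neg (ChainSharp C) := ⟨fun x => pair (-x.int - 1) (mvNeg x.val)⟩

/-- `(m, a) (n, b) = mn (0, u²) + m (0, b u) + n (0, a u) + (0, a b)`, where integer multiples
are iterated sums. -/
noncomputable instance : Mul (ChainSharp C) :=
  ⟨fun x y => zsmulRec nsmulRec (x.int * y.int) (pair 0 (top C * top C))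
    + zsmulRec nsmulRec x.int (pair 0 (y.val * top C))
    + zsmulRec nsmulRec y.int (pair 0 (x.val * top C))
    + pair 0 (x.val * y.val)⟩

/-- The lexicographic order. -/
instance : LE (ChainSharp C) := ⟨fun x y => x.int < y.int ∨ x.int = y.int ∧ Le x.val y.val⟩

open Classical in
noncomputable instance : Max (ChainSharp C) := ⟨fun x y => if x ≤ y then y else x⟩

open Classical in
noncomputable instance : Min (ChainSharp C) := ⟨fun x y => if x ≤ y then x else y⟩

end ChainSharp

/-- The product of the `(A / P)^♯` over the prime spectrum, with pointwise operations and order. -/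
abbrev SharpProd (A : Type*) [PMVf A] : Type _ := ∀ P : MVSpec A, ChainSharp P.toMVIdeal.Quo

/-- The element `(0, â)`, whose coordinate at `P` is `(0, [a]_P)`. -/
noncomputable def sharpHat {A : Type*} [PMVf A] (a : A) : SharpProd A :=
  fun P => ChainSharp.pair 0 (P.cls a)

/-- Membership in the sub-`l`-ring of the product generated by the elements `(0, â)`. -/
inductive SharpGen {A : Type*} [PMVf A] : SharpProd A → Prop
  | hat (a : A) : SharpGen (sharpHat a)
  | zero : SharpGen 0
  | add {x y : SharpProd A} : SharpGen x → SharpGen y → SharpGen (x + y)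
  | neg {x : SharpProd A} : SharpGen x → SharpGen (-x)
  | mul {x y : SharpProd A} : SharpGen x → SharpGen y → SharpGen (x * y)
  | sup {x y : SharpProd A} : SharpGen x → SharpGen y → SharpGen (x ⊔ y)
  | inf {x y : SharpProd A} : SharpGen x → SharpGen y → SharpGen (x ⊓ y)

/-- The associated ring `A^♯`. -/
structure Sharp (A : Type*) [PMVf A] where
  val : SharpProd A
  gen : SharpGen val

/-- The element `u = (0, û)` of `A^♯`. -/
noncomputable def Sharp.unit (A : Type*) [PMVf A] : Sharp A :=
  ⟨sharpHat (MVAlgebra.top A), SharpGen.hat _⟩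

/-- A (commutative, not necessarily unital) `l`-ring. -/
structure IsLRing (R : Type*) [NonUnitalCommRing R] [Lattice R] : Prop where
  add_le_add_left : ∀ x y z : R, x ≤ y → z + x ≤ z + y
  mul_nonneg : ∀ x y : R, 0 ≤ x → 0 ≤ y → 0 ≤ x * y

/-- `u` is a strong unit of the underlying `l`-group. -/
structure IsStrongUnit {R : Type*} [NonUnitalCommRing R] [Lattice R] (u : R) : Prop where
  nonneg : 0 ≤ u
  bound : ∀ x : R, ∃ n : ℕ, |x| ≤ n • u

/-- A semi-low `l_u`-ring `(R, u)`. -/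
structure IsSemiLowLuRing (R : Type*) [NonUnitalCommRing R] [Lattice R] (u : R) : Prop where
  lring : IsLRing R
  strongUnit : IsStrongUnit u
  semiLow : ∀ a b : R, a ∈ Set.Icc 0 u → b ∈ Set.Icc 0 u → a * b ≤ a ⊓ b

/-- An `f`-ring. -/
structure IsFRing (R : Type*) [NonUnitalCommRing R] [Lattice R] : Prop where
  lring : IsLRing R
  disjoint : ∀ a b c : R, a ⊓ b = 0 → 0 ≤ c → a * c ⊓ b = 0 ∧ a ⊓ c * b = 0

/-- A semi-low `f_u`-ring `(R, u)`: a semi-low `l_u`-ring that is an `f`-ring. -/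
structure IsSemiLowFuRing (R : Type*) [NonUnitalCommRing R] [Lattice R] (u : R) : Prop where
  semiLow : IsSemiLowLuRing R u
  fring : IsFRing R

/-! Everything reduces to one chain `C = A/P`: `C^♯` is a totally ordered commutative ring whose
unit interval is `C`. Its addition is that of a carry. In a chain, a sum `a ⊕ b` either reaches `u`
or is untruncated, meaning `a ⊙ b = 0` (`odot_eq_zero_of_add_ne_top`). Associativity is then three
MV-identities relating `⊕` and `⊙`, one for each pattern of carries. For the product, `c (a ⊖ b) =
ca ⊖ cb` makes multiplication by `c` extend to an additive map of `C^♯` (`mulHom`), which gives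
distributivity. Since `(m, a) = m (0, u) + (0, a)`, the elements `(0, a)` generate `C^♯` additively,
and on them the product is that of `C`; associativity transfers by additivity (`addHom_ext`). In a
totally ordered ring, disjoint elements include a zero, hence the `f`-property; semi-lowness is `ab
≤ a ∧ b` in `C`. Prelinearity makes each `A/P` a chain, and all these laws hold coordinatewise in
the product and so in `A^♯`. Only the strong unit needs generation: a bound uniform in `P` is built
by induction. -/

namespace MVAlgebra

/-! ### MV-algebra arithmetic -/

variable {A : Type*} [MVAlgebra A]

theorem le_antisymm' {x y : A} (h : Le x y) (h' : Le y x) : x = y := by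
  have h2 := mv_comm x y
  change tsub x y + y = tsub y x + x at h2
  rw [show tsub x y = 0 from h, show tsub y x = 0 from h', zero_add, zero_add] at h2
  exact h2.symm

theorem zero_le' (x : A) : Le 0 x := (le_iff_exists _ _).2 ⟨x, zero_add x⟩

theorem le_top' (x : A) : Le x (top A) := (le_iff_exists _ _).2 ⟨top A, add_top x⟩

theorem eq_zero_of_le {x : A} (h : Le x 0) : x = 0 := le_antisymm' h (zero_le' x)

theorem eq_top_of_le {x : A} (h : Le (top A) x) : x = top A := le_antisymm' (le_top' x) h

theorem tsub_zero' (x : A) : tsub x 0 = x := by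
  rw [tsub, add_zero, mvNeg_mvNeg]

theorem top_tsub (x : A) : tsub (top A) x = mvNeg x := by
  rw [tsub, neg_top, zero_add]

theorem tsub_tsub' (x y z : A) : tsub (tsub x y) z = tsub x (y + z) := by
  rw [tsub, tsub, tsub, mvNeg_mvNeg, add_assoc]

theorem tsub_le_self' (x y : A) : Le (tsub x y) x := by
  rw [tsub_le_iff, add_comm]
  exact le_add_right' x y

theorem tsub_add_of_le {x y : A} (h : Le y x) : tsub x y + y = x := by
  have h2 := mv_comm x y
  change tsub x y + y = tsub y x + x at h2
  rwa [show tsub y x = 0 from h, zero_add] at h2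

theorem odot_comm (x y : A) : odot x y = odot y x := by
  rw [odot, odot, add_comm]

theorem odot_eq_tsub (x y : A) : odot x y = tsub x (mvNeg y) := rfl

theorem odot_assoc (x y z : A) : odot (odot x y) z = odot x (odot y z) := by
  simp only [odot, mvNeg_mvNeg, add_assoc]

theorem odot_top (x : A) : odot x (top A) = x := by
  rw [odot, neg_top, add_zero, mvNeg_mvNeg]

theorem odot_mvNeg (x : A) : odot x (mvNeg x) = 0 := by
  rw [odot, mvNeg_mvNeg, neg_add_self, neg_top]

theorem odot_le_left (x y : A) : Le (odot x y) x := tsub_le_self' _ _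

theorem mvNeg_odot (x y : A) : mvNeg (odot x y) = mvNeg x + mvNeg y := mvNeg_mvNeg _

theorem odot_mvNeg_mvNeg (x y : A) : odot (mvNeg x) (mvNeg y) = mvNeg (x + y) := by
  rw [odot, mvNeg_mvNeg, mvNeg_mvNeg]

theorem add_eq_top_iff (x y : A) : x + y = top A ↔ Le (mvNeg x) y := by
  rw [le_iff, mvNeg_mvNeg]

theorem odot_eq_zero_iff (x y : A) : odot x y = 0 ↔ Le x (mvNeg y) := Iff.rfl

theorem odot_le_odot {x y : A} (z : A) (h : Le x y) : Le (odot z x) (odot z y) := by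
  rw [odot_comm z x, odot_eq_tsub, tsub_le_iff, odot_comm z y, odot_eq_tsub]
  exact le_trans' h (le_add_tsub _ _)

/-- Cancellation for sums that are not truncated. -/
theorem add_tsub_cancel {x y : A} (h : odot x y = 0) : tsub (x + y) y = x := by
  have h2 := mv_comm (mvNeg x) y
  rw [mvNeg_mvNeg, add_comm (mvNeg y), show mvNeg (mvNeg x + mvNeg y) = 0 from h, zero_add] at h2
  rw [tsub, h2, mvNeg_mvNeg]

/-- Since `y ≤ ¬z`, subtracting `¬z` from `x ⊕ y` amounts to subtracting `y`, which leaves `x`, and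
then `¬z ⊖ y = ¬(y ⊕ z)`. -/
theorem odot_add_of_odot_eq_zero {x y z : A} (h : odot x y = 0) (h' : odot y z = 0) :
    odot (x + y) z = odot x (y + z) := by
  have hw : y + tsub (mvNeg z) y = mvNeg z := by
    rw [add_comm]; exact tsub_add_of_le h'
  have hd : mvNeg (y + z) = tsub (mvNeg z) y := by
    rw [tsub, mvNeg_mvNeg, add_comm]
  rw [odot_eq_tsub, odot_eq_tsub, ← hw, ← tsub_tsub', add_tsub_cancel h, hd]

/-- The De Morgan dual of `odot_add_of_odot_eq_zero`. -/
theorem odot_add_of_add_eq_top {x y z : A} (h : x + y = top A) (h' : y + z = top A) :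
    odot x y + z = x + odot y z := by
  have h1 : odot (mvNeg x) (mvNeg y) = 0 := by rw [odot_mvNeg_mvNeg, h, neg_top]
  have h2 : odot (mvNeg y) (mvNeg z) = 0 := by rw [odot_mvNeg_mvNeg, h', neg_top]
  have h3 := congrArg mvNeg (odot_add_of_odot_eq_zero h1 h2)
  rw [mvNeg_odot, mvNeg_odot, mvNeg_mvNeg, mvNeg_mvNeg] at h3
  exact h3

/-- Here `y = (x ⊙ y) ⊕ ¬x`, so `y ⊕ z` is `(x ⊙ y) ⊕ z` plus `¬x`. This sum is untruncated because
`(x ⊙ y) ⊕ z ≤ x`, so `¬x` can be subtracted again. -/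
theorem odot_add_of_mixed {x y z : A} (h : x + y = top A) (h' : odot y z = 0) :
    odot x y + z = odot x (y + z) := by
  have he : odot x y + mvNeg x = y := by
    rw [odot_comm, odot_eq_tsub]
    exact tsub_add_of_le ((add_eq_top_iff _ _).1 h)
  have hle : Le (odot x y + z) x := by
    have h1 : Le z (tsub x (odot x y)) := by
      rw [odot_comm, odot_eq_zero_iff] at h'
      rw [tsub, add_comm, he]
      exact h'
    have h2 := add_le_add' h1 (le_refl' (odot x y))
    rwa [tsub_add_of_le (odot_le_left x y), add_comm] at h2
  have h0 : odot (odot x y + z) (mvNeg x) = 0 := by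
    rw [odot_eq_zero_iff, mvNeg_mvNeg]; exact hle
  have h3 := add_tsub_cancel h0
  rw [add_right_comm, he] at h3
  rw [odot_comm x (y + z), odot_eq_tsub (y + z), h3]

/-- By De Morgan the meet is `¬(¬x ∨ ¬y)`, and `mv_comm` is the symmetry of the join. -/
theorem inf_comm' (x y : A) : inf x y = inf y x := by
  have h := mv_comm (mvNeg x) (mvNeg y)
  have key : ∀ a b : A, inf a b = mvNeg (mvNeg (mvNeg (mvNeg a) + mvNeg b) + mvNeg b) := by
    intro a b
    have h := mv_comm (mvNeg a) (mvNeg b)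
    rw [h]
    simp only [inf, tsub, mvNeg_mvNeg]
    rw [add_comm b, add_comm (mvNeg a) (mvNeg (mvNeg a + b))]
  rw [key x y, h, key y x]

theorem le_inf' {x y z : A} (h : Le z x) (h' : Le z y) : Le z (inf x y) := by
  have h1 : Le (tsub x y) (tsub x z) := by
    rw [tsub_le_iff]
    exact le_trans' (le_add_tsub x z) (add_le_add' h' (le_refl' _))
  have h2 : tsub x (tsub x z) = z := by
    change inf x z = z
    rw [inf_comm', inf, show tsub z x = 0 from h, tsub_zero']
  rw [← h2, inf, tsub_le_iff]
  exact le_trans' (le_add_tsub x (tsub x y)) (add_le_add' h1 (le_refl' _))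

theorem inf_le_right' (x y : A) : Le (inf x y) y := by
  rw [inf_comm']; exact inf_le_left' y x

theorem tsub_inf_right (x y : A) : tsub x (inf x y) = tsub x y := by
  change inf x (tsub x y) = tsub x y
  rw [inf_comm', inf, show tsub (tsub x y) x = 0 from tsub_le_self' x y, tsub_zero']

/-- Prelinearity of MV-algebras. -/
theorem inf_tsub_tsub (x y : A) : inf (tsub x y) (tsub y x) = 0 := by
  have hx : tsub x y + inf x y = x := by
    have := tsub_add_of_le (inf_le_left' x y)
    rwa [tsub_inf_right] at this
  have hy : tsub y x + inf x y = y := by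
    have := tsub_add_of_le (inf_le_left' y x)
    rwa [tsub_inf_right, inf_comm' y x] at this
  set d := inf (tsub x y) (tsub y x) with hd
  have h1 : Le (d + inf x y) (inf x y) := by
    apply le_inf'
    · have := add_le_add' (inf_le_left' (tsub x y) (tsub y x)) (le_refl' (inf x y))
      rwa [hx] at this
    · have := add_le_add' (inf_le_right' (tsub x y) (tsub y x)) (le_refl' (inf x y))
      rwa [hy] at this
  -- The sum `d ⊕ (x ∧ y)` is untruncated, so `x ∧ y` cancels from `d ⊕ (x ∧ y) ≤ x ∧ y`.
  have h2 : odot d (inf x y) = 0 := by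
    rw [odot_eq_zero_iff]
    refine le_trans' (inf_le_left' _ _) ?_
    rw [← tsub_inf_right, ← top_tsub, tsub_le_iff]
    exact le_trans' (le_top' x) (le_add_tsub _ _)
  have h3 := add_tsub_cancel h2
  rw [← h3]
  exact h1

end MVAlgebra

/-- An MV-algebra whose order is total. -/
class IsMVChain (C : Type*) [MVAlgebra C] : Prop where
  total : ∀ a b : C, MVAlgebra.Le a b ∨ MVAlgebra.Le b a

namespace MVAlgebra

theorem odot_eq_zero_of_add_ne_top {C : Type*} [MVAlgebra C] [IsMVChain C] {a b : C}
    (h : a + b ≠ top C) : odot a b = 0 := by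
  rcases IsMVChain.total a (mvNeg b) with h' | h'
  · exact h'
  · rw [Ne, add_comm, add_eq_top_iff] at h
    exact absurd h' h

end MVAlgebra

/-! ### The ordered additive group `C^♯` -/

namespace ChainSharp

open MVAlgebra

variable {C : Type*} [PMVf C]

@[ext]
theorem ext' {x y : ChainSharp C} (h : x.int = y.int) (h' : x.val = y.val) : x = y := by
  cases x; cases y; cases h; cases h'; rfl

theorem le_def (x y : ChainSharp C) :
    x ≤ y ↔ x.int < y.int ∨ x.int = y.int ∧ Le x.val y.val := Iff.rfl

variable [Nontrivial C]

theorem pair_of_ne {a : C} (m : ℤ) (h : a ≠ top C) : pair m a = ⟨m, a, h⟩ := dif_neg h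

theorem pair_top (m : ℤ) : pair m (top C) = pair (m + 1) 0 := by
  rw [pair_of_ne _ zero_ne_top, pair, dif_pos rfl]

theorem pair_int_val (x : ChainSharp C) : pair x.int x.val = x := pair_of_ne _ x.ne_top

theorem exists_pair (x : ChainSharp C) : ∃ m a, a ≠ top C ∧ x = pair m a :=
  ⟨x.int, x.val, x.ne_top, (pair_int_val x).symm⟩

theorem zero_def : (0 : ChainSharp C) = pair 0 0 := rfl

theorem int_pair_of_ne {a : C} (m : ℤ) (h : a ≠ top C) : (pair m a).int = m := by
  rw [pair_of_ne m h]

theorem val_pair_of_ne {a : C} (m : ℤ) (h : a ≠ top C) : (pair m a).val = a := by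
  rw [pair_of_ne m h]

theorem neg_pair (m : ℤ) (a : C) : -pair m a = pair (-m - 1) (mvNeg a) := by
  by_cases h : a = top C
  · subst h
    rw [pair_top, neg_top]
    change pair (-(pair (m + 1) (0 : C)).int - 1) (mvNeg (pair (m + 1) (0 : C)).val) = _
    rw [int_pair_of_ne _ zero_ne_top, val_pair_of_ne _ zero_ne_top]
    change pair _ (top C) = _
    rw [pair_top]
    congr 1; ring
  · change pair (-(pair m a).int - 1) (mvNeg (pair m a).val) = _
    rw [int_pair_of_ne _ h, val_pair_of_ne _ h]

theorem add_of_eq_top {x y : ChainSharp C} (h : x.val + y.val = top C) :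
    x + y = pair (x.int + y.int + 1) (odot x.val y.val) := if_pos h

theorem add_of_ne_top {x y : ChainSharp C} (h : x.val + y.val ≠ top C) :
    x + y = pair (x.int + y.int) (x.val + y.val) := if_neg h

theorem add_comm' (x y : ChainSharp C) : x + y = y + x := by
  by_cases h : x.val + y.val = top C
  · rw [add_of_eq_top h, add_of_eq_top (by rwa [add_comm]), odot_comm, add_comm x.int]
  · rw [add_of_ne_top h, add_of_ne_top (by rwa [add_comm]), add_comm x.val, add_comm x.int]

theorem zero_add' (x : ChainSharp C) : 0 + x = x := by
  have hv : (0 : ChainSharp C).val = 0 := val_pair_of_ne _ zero_ne_top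
  have hi : (0 : ChainSharp C).int = 0 := int_pair_of_ne _ zero_ne_top
  rw [add_of_ne_top (by rw [hv, zero_add]; exact x.ne_top), hv, hi, zero_add, zero_add,
    pair_int_val]

/-- Addition is defined on reduced representatives; this and `pair_add_pair_of_ne_top` allow the
unreduced `(m, u)` as well. -/
theorem pair_add_pair_of_eq_top {a b : C} (m n : ℤ) (h : a + b = top C) :
    pair m a + pair n b = pair (m + n + 1) (odot a b) := by
  by_cases ha : a = top C
  · subst ha
    rw [pair_top, odot_comm, odot_top]
    by_cases hb : b = top C
    · subst hb
      rw [pair_top, add_of_ne_top (by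
        rw [val_pair_of_ne _ zero_ne_top, val_pair_of_ne _ zero_ne_top, add_zero]
        exact zero_ne_top), val_pair_of_ne _ zero_ne_top, val_pair_of_ne _ zero_ne_top,
        int_pair_of_ne _ zero_ne_top, int_pair_of_ne _ zero_ne_top, add_zero, pair_top]
      congr 1; ring
    · rw [add_of_ne_top (by
        rw [val_pair_of_ne _ zero_ne_top, val_pair_of_ne _ hb, zero_add]
        exact hb), val_pair_of_ne _ zero_ne_top, val_pair_of_ne _ hb,
        int_pair_of_ne _ zero_ne_top, int_pair_of_ne _ hb, zero_add]
      congr 1; ring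
  · by_cases hb : b = top C
    · subst hb
      rw [pair_top, odot_top, add_of_ne_top (by
        rw [val_pair_of_ne _ ha, val_pair_of_ne _ zero_ne_top, add_zero]
        exact ha), val_pair_of_ne _ ha, val_pair_of_ne _ zero_ne_top,
        int_pair_of_ne _ ha, int_pair_of_ne _ zero_ne_top, add_zero]
      congr 1; ring
    · rw [add_of_eq_top (by rwa [val_pair_of_ne _ ha, val_pair_of_ne _ hb]),
        val_pair_of_ne _ ha, val_pair_of_ne _ hb, int_pair_of_ne _ ha, int_pair_of_ne _ hb]

theorem pair_add_pair_of_ne_top {a b : C} (m n : ℤ) (h : a + b ≠ top C) :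
    pair m a + pair n b = pair (m + n) (a + b) := by
  have ha : a ≠ top C := by
    rintro rfl; rw [add_comm, MVAlgebra.add_top] at h; exact h rfl
  have hb : b ≠ top C := by
    rintro rfl; rw [MVAlgebra.add_top] at h; exact h rfl
  rw [add_of_ne_top (by rwa [val_pair_of_ne _ ha, val_pair_of_ne _ hb]),
    val_pair_of_ne _ ha, val_pair_of_ne _ hb, int_pair_of_ne _ ha, int_pair_of_ne _ hb]

theorem neg_add_cancel' (x : ChainSharp C) : -x + x = 0 := by
  obtain ⟨m, a, -, rfl⟩ := exists_pair x
  rw [neg_pair, pair_add_pair_of_eq_top _ _ (neg_add_self a), odot_comm, odot_mvNeg, zero_def]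
  congr 1; ring

theorem add_le_add_left' (x y z : ChainSharp C) (hxy : x ≤ y) : z + x ≤ z + y := by
  have hval : ∀ {a b : C}, a ≠ top C → odot a b ≠ top C := by
    intro a b ha h
    exact ha (eq_top_of_le (h ▸ odot_le_left a b))
  by_cases hx : z.val + x.val = top C <;> by_cases hy : z.val + y.val = top C
  · rw [add_of_eq_top hx, add_of_eq_top hy, pair_of_ne _ (hval z.ne_top),
      pair_of_ne _ (hval z.ne_top)]
    rcases hxy with h | ⟨h, h'⟩
    · left; dsimp; omega
    · right; exact ⟨by dsimp; omega, odot_le_odot _ h'⟩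
  · rw [add_of_eq_top hx, add_of_ne_top hy, pair_of_ne _ (hval z.ne_top), pair_of_ne _ hy]
    rcases hxy with h | ⟨h, h'⟩
    -- If `y.int = x.int + 1`, the carry closes the gap, and `z ⊙ x ≤ z ≤ z ⊕ y` decides.
    · rcases (Int.add_one_le_iff.2 h).lt_or_eq with h2 | h2
      · left; dsimp; omega
      · right
        exact ⟨by dsimp; omega, le_trans' (odot_le_left _ _) (le_add_right' _ _)⟩
    · exfalso
      apply hy
      apply eq_top_of_le
      rw [← hx]
      exact add_le_add' (le_refl' _) h'
  · rw [add_of_ne_top hx, add_of_eq_top hy, pair_of_ne _ (hval z.ne_top), pair_of_ne _ hx]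
    left
    rcases hxy with h | ⟨h, h'⟩ <;> dsimp <;> omega
  · rw [add_of_ne_top hx, add_of_ne_top hy, pair_of_ne _ hx, pair_of_ne _ hy]
    rcases hxy with h | ⟨h, h'⟩
    · left; dsimp; omega
    · right; exact ⟨by dsimp; omega, add_le_add' (le_refl' _) h'⟩

theorem pair_add_int (m n : ℤ) (a : C) : pair (m + n) a = pair m 0 + pair n a := by
  by_cases h : a = top C
  · subst h
    rw [pair_add_pair_of_eq_top _ _ (MVAlgebra.add_top 0), odot_top, pair_top]
  · rw [pair_add_pair_of_ne_top _ _ (by rwa [zero_add]), zero_add]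

theorem int_nonneg {x : ChainSharp C} (h : 0 ≤ x) : 0 ≤ x.int := by
  have hi : (0 : ChainSharp C).int = 0 := int_pair_of_ne _ zero_ne_top
  rw [le_def, hi] at h
  rcases h with h | ⟨h, -⟩ <;> omega

/-- The unit interval of `C^♯` is `C`. -/
theorem exists_eq_pair_zero {x : ChainSharp C} (h : 0 ≤ x) (h' : x ≤ pair 0 (top C)) :
    ∃ a, x = pair 0 a := by
  have h0 := int_nonneg h
  rw [pair_top, pair_of_ne _ zero_ne_top, le_def] at h'
  dsimp only at h'
  rcases h' with h' | ⟨h', h2⟩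
  · refine ⟨x.val, ?_⟩
    conv_lhs => rw [← pair_int_val x]
    congr 1; omega
  · refine ⟨top C, ?_⟩
    conv_lhs => rw [← pair_int_val x]
    rw [h', eq_zero_of_le h2, pair_top]

variable [IsMVChain C]

/-- The cases record whether `a ⊕ b` and `b ⊕ c` carry; both bracketings then have the same total
number of carries. -/
theorem add_assoc' (x y z : ChainSharp C) : x + y + z = x + (y + z) := by
  obtain ⟨m, a, -, rfl⟩ := exists_pair x
  obtain ⟨n, b, -, rfl⟩ := exists_pair y
  obtain ⟨k, c, -, rfl⟩ := exists_pair z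
  by_cases h : a + b = top C <;> by_cases h' : b + c = top C
  · rw [pair_add_pair_of_eq_top _ _ h, pair_add_pair_of_eq_top _ _ h']
    have e := odot_add_of_add_eq_top h h'
    by_cases ht : odot a b + c = top C
    · rw [pair_add_pair_of_eq_top _ _ ht, pair_add_pair_of_eq_top _ _ (e ▸ ht), odot_assoc]
      congr 1; ring
    · rw [pair_add_pair_of_ne_top _ _ ht, pair_add_pair_of_ne_top _ _ (e ▸ ht), e]
      congr 1; ring
  · have e := odot_add_of_mixed h (odot_eq_zero_of_add_ne_top h')
    rw [pair_add_pair_of_eq_top _ _ h, pair_add_pair_of_ne_top _ _ h']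
    have h1 : a + (b + c) = top C := by rw [← add_assoc, h, add_comm, MVAlgebra.add_top]
    have h2 : odot a b + c ≠ top C := by
      intro ht
      apply h'
      apply eq_top_of_le
      rw [← ht, odot_comm]
      exact add_le_add' (odot_le_left b a) (le_refl' c)
    rw [pair_add_pair_of_ne_top _ _ h2, pair_add_pair_of_eq_top _ _ h1, e]
    congr 1; ring
  · have hba : odot b a = 0 := by rw [odot_comm]; exact odot_eq_zero_of_add_ne_top h
    -- The mirror image of the preceding case, with `a` and `c` exchanged.
    have e := odot_add_of_mixed (by rwa [add_comm] : c + b = top C) hba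
    rw [pair_add_pair_of_ne_top _ _ h, pair_add_pair_of_eq_top _ _ h']
    have h1 : a + b + c = top C := by rw [add_assoc, h', MVAlgebra.add_top]
    have h2 : a + odot b c ≠ top C := by
      intro ht
      apply h
      apply eq_top_of_le
      rw [← ht]
      exact add_le_add' (le_refl' a) (odot_le_left b c)
    rw [pair_add_pair_of_ne_top _ _ h2, pair_add_pair_of_eq_top _ _ h1, odot_comm (a + b),
      add_comm a b, ← e, add_comm a, odot_comm b c]
    congr 1; ring
  · have e := odot_add_of_odot_eq_zero (odot_eq_zero_of_add_ne_top h)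
      (odot_eq_zero_of_add_ne_top h')
    rw [pair_add_pair_of_ne_top _ _ h, pair_add_pair_of_ne_top _ _ h']
    by_cases ht : a + b + c = top C
    · rw [pair_add_pair_of_eq_top _ _ ht, pair_add_pair_of_eq_top _ _ (add_assoc a b c ▸ ht), e]
      congr 1; ring
    · rw [pair_add_pair_of_ne_top _ _ ht, pair_add_pair_of_ne_top _ _ (add_assoc a b c ▸ ht),
        add_assoc a b c]
      congr 1; ring

noncomputable scoped instance : AddCommGroup (ChainSharp C) where
  add_assoc := add_assoc'
  zero_add := zero_add'
  add_zero x := by rw [add_comm', zero_add']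
  -- These are the recursions used in the definition of the product, so `mul_def'` holds by `rfl`.
  nsmul := nsmulRec
  zsmul := zsmulRec nsmulRec
  neg_add_cancel := neg_add_cancel'
  add_comm := add_comm'

noncomputable scoped instance : LinearOrder (ChainSharp C) where
  le_refl x := Or.inr ⟨rfl, le_refl' _⟩
  le_trans x y z := by
    rintro (h | ⟨h, h'⟩) (k | ⟨k, k'⟩)
    · exact Or.inl (h.trans k)
    · exact Or.inl (k ▸ h)
    · exact Or.inl (h ▸ k)
    · exact Or.inr ⟨h.trans k, le_trans' h' k'⟩
  le_antisymm x y := by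
    rintro (h | ⟨h, h'⟩) (k | ⟨k, k'⟩)
    · omega
    · omega
    · omega
    · exact ext' h (le_antisymm' h' k')
  le_total x y := by
    rcases lt_trichotomy x.int y.int with h | h | h
    · exact Or.inl (Or.inl h)
    · rcases IsMVChain.total x.val y.val with h' | h'
      · exact Or.inl (Or.inr ⟨h, h'⟩)
      · exact Or.inr (Or.inr ⟨h.symm, h'⟩)
    · exact Or.inr (Or.inl h)
  toDecidableLE := Classical.decRel _
  min_def _ _ := rfl
  max_def _ _ := rfl

scoped instance : IsOrderedAddMonoid (ChainSharp C) where
  add_le_add_left x y h z := by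
    rw [add_comm x, add_comm y]; exact add_le_add_left' x y z h

theorem pair_zero_add_pair_zero (a b : C) :
    pair 0 a + pair 0 b = pair 0 (a + b) + pair 0 (odot a b) := by
  by_cases h : a + b = top C
  · have h' : top C + odot a b = top C := by rw [add_comm, MVAlgebra.add_top]
    rw [pair_add_pair_of_eq_top _ _ h, h, pair_add_pair_of_eq_top _ _ h', odot_comm (top C),
      odot_top]
  · rw [pair_add_pair_of_ne_top _ _ h, odot_eq_zero_of_add_ne_top h, ← zero_def, zero_add, add_zero]

theorem pair_tsub {a b : C} (h : Le b a) : pair 0 (tsub a b) = pair 0 a - pair 0 b := by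
  have h1 : odot (tsub a b) b = 0 := by
    rw [odot_eq_zero_iff, ← top_tsub, tsub_le_iff]
    exact le_trans' (le_top' a) (le_add_tsub _ _)
  rw [eq_sub_iff_add_eq, pair_zero_add_pair_zero, tsub_add_of_le h, h1, ← zero_def, add_zero]

/-- `m ↦ (m, 0)` is additive and sends `1` to `(1, 0) = (0, u)`. -/
theorem pair_eq (m : ℤ) (a : C) : pair m a = m • pair 0 (top C) + pair 0 a := by
  let f : ℤ →+ ChainSharp C :=
    { toFun := fun m => pair m 0
      map_zero' := rfl
      map_add' := fun m n => pair_add_int m n 0 }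
  have h : pair m (0 : C) = m • pair 0 (top C) := by
    have h1 := map_zsmul f m 1
    rw [zsmul_eq_mul, mul_one] at h1
    have h2 : f 1 = pair 0 (top C) := by rw [pair_top, zero_add]; rfl
    rw [← h2, ← h1]; rfl
  rw [← h, ← pair_add_int, add_zero]

theorem pair_mono {a b : C} (h : Le a b) : pair 0 a ≤ pair 0 b := by
  by_cases hb : b = top C
  · by_cases ha : a = top C
    · rw [ha, hb]
    · rw [hb, pair_top, pair_of_ne _ ha, pair_of_ne _ zero_ne_top]
      left; dsimp; omega
  · have ha : a ≠ top C := by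
      rintro rfl; exact hb (eq_top_of_le h)
    rw [pair_of_ne _ ha, pair_of_ne _ hb]
    exact Or.inr ⟨rfl, h⟩

theorem pair_nonneg (a : C) : 0 ≤ pair 0 a := pair_mono (zero_le' a)

/-! ### The product on `C^♯` -/

theorem mul_def' (x y : ChainSharp C) :
    x * y = (x.int * y.int) • pair 0 (top C * top C) + x.int • pair 0 (y.val * top C)
      + y.int • pair 0 (x.val * top C) + pair 0 (x.val * y.val) := rfl

/-- The additive extension to `C^♯` of multiplication by `c` on `C`. -/
noncomputable def mulHom (c : C) : ChainSharp C →+ ChainSharp C :=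
  AddMonoidHom.mk' (fun x => x.int • pair 0 (c * top C) + pair 0 (c * x.val)) <| by
    have hsub : ∀ {a b : C}, Le b a →
        pair 0 (c * tsub a b) = pair 0 (c * a) - pair 0 (c * b) := by
      intro a b h
      rw [PMVf.mul_tsub, pair_tsub]
      rw [Le, ← PMVf.mul_tsub, show tsub b a = 0 from h, MVWRig.mul_zero']
    intro x y
    by_cases h : x.val + y.val = top C
    · have hn : odot x.val y.val ≠ top C := fun h' =>
        x.ne_top (eq_top_of_le (h' ▸ odot_le_left x.val y.val))
      -- With a carry, `a ⊙ b = a ⊖ (u ⊖ b)`, so `c (a ⊙ b)` becomes `ca - cu + cb`; the carried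
      -- integer restores `cu`.
      have h1 : Le (mvNeg y.val) x.val := by rwa [← add_eq_top_iff, add_comm]
      rw [add_of_eq_top h, pair_of_ne _ hn]
      dsimp only
      rw [odot_eq_tsub, hsub h1, ← top_tsub, hsub (le_top' _)]
      simp only [add_smul, one_smul]
      abel
    -- Without a carry, `a = (a ⊕ b) ⊖ b`, and `c` respects this difference.
    · have h1 := add_tsub_cancel (odot_eq_zero_of_add_ne_top h)
      have h2 : Le y.val (x.val + y.val) := by rw [add_comm]; exact le_add_right' _ _
      have h3 := hsub h2
      rw [h1] at h3
      rw [add_of_ne_top h, pair_of_ne _ h]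
      dsimp only
      rw [h3, add_smul]
      abel

theorem mul_eq_mulHom (x y : ChainSharp C) :
    x * y = x.int • mulHom (top C) y + mulHom x.val y := by
  rw [mul_def']
  simp only [mulHom, AddMonoidHom.mk'_apply, smul_add, smul_smul, mul_comm (top C) y.val]
  abel

theorem mul_comm'' (x y : ChainSharp C) : x * y = y * x := by
  rw [mul_def', mul_def', mul_comm x.int, mul_comm x.val y.val]
  abel

theorem mul_add' (x y z : ChainSharp C) : x * (y + z) = x * y + x * z := by
  simp only [mul_eq_mulHom, map_add, smul_add]
  abel

theorem add_mul' (x y z : ChainSharp C) : (x + y) * z = x * z + y * z := by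
  rw [mul_comm'', mul_add', mul_comm'' z, mul_comm'' z]

theorem mulHom_pair (c a : C) : mulHom c (pair 0 a) = pair 0 (c * a) := by
  by_cases h : a = top C
  · subst h
    rw [pair_top, pair_of_ne _ zero_ne_top, mulHom, AddMonoidHom.mk'_apply]
    dsimp only
    rw [zero_add, one_smul, MVWRig.mul_zero', ← zero_def, add_zero]
  · rw [pair_of_ne _ h, mulHom, AddMonoidHom.mk'_apply]
    dsimp only
    rw [zero_smul, zero_add]

theorem pair_mul_pair (a b : C) : pair 0 a * pair 0 b = pair 0 (a * b) := by
  rw [mul_eq_mulHom, mulHom_pair, mulHom_pair]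
  by_cases h : a = top C
  · subst h
    rw [pair_top, pair_of_ne _ zero_ne_top]
    dsimp only
    rw [zero_add, one_smul, mul_comm 0, MVWRig.mul_zero', ← zero_def, add_zero]
  · rw [pair_of_ne _ h]
    dsimp only
    rw [zero_smul, zero_add]

/-- Left multiplication as an additive homomorphism. -/
noncomputable def mulLeftHom (x : ChainSharp C) : ChainSharp C →+ ChainSharp C :=
  AddMonoidHom.mk' (fun y => x * y) (mul_add' x)

theorem addHom_ext {f g : ChainSharp C →+ ChainSharp C}
    (h : ∀ a, f (pair 0 a) = g (pair 0 a)) : f = g := by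
  ext1 x
  rw [← pair_int_val x, pair_eq, map_add, map_add, map_zsmul, map_zsmul, h, h]

/-- Both sides are additive in each factor and agree on elements `(0, a)`. The factors are freed one
at a time: the third in `h1`, the second in `h2`, the first at the end. -/
theorem mul_assoc' (x y z : ChainSharp C) : x * y * z = x * (y * z) := by
  have h1 : ∀ (a b : C) (z : ChainSharp C),
      pair 0 a * pair 0 b * z = pair 0 a * (pair 0 b * z) := by
    intro a b z
    have : mulLeftHom (pair 0 a * pair 0 b)
        = (mulLeftHom (pair 0 a)).comp (mulLeftHom (pair 0 b)) := by
      apply addHom_ext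
      intro c
      change pair 0 a * pair 0 b * pair 0 c = pair 0 a * (pair 0 b * pair 0 c)
      simp only [pair_mul_pair, mul_assoc]
    exact DFunLike.congr_fun this z
  have h2 : ∀ (a : C) (y z : ChainSharp C), pair 0 a * y * z = pair 0 a * (y * z) := by
    intro a y z
    have : (mulLeftHom z).comp (mulLeftHom (pair 0 a))
        = (mulLeftHom (pair 0 a)).comp (mulLeftHom z) := by
      apply addHom_ext
      intro b
      change z * (pair 0 a * pair 0 b) = pair 0 a * (z * pair 0 b)
      rw [mul_comm'', h1, mul_comm'' (pair 0 b)]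
    have h3 : z * (pair 0 a * y) = pair 0 a * (z * y) := DFunLike.congr_fun this y
    rw [mul_comm'', h3, mul_comm'' z]
  have : (mulLeftHom z).comp (mulLeftHom y) = mulLeftHom (y * z) := by
    apply addHom_ext
    intro a
    change z * (y * pair 0 a) = y * z * pair 0 a
    rw [mul_comm'' z, mul_comm'' y, h2, mul_comm'' (pair 0 a)]
  have h3 : z * (y * x) = y * z * x := DFunLike.congr_fun this x
  rw [mul_comm'', mul_comm'' x y, h3, mul_comm'']

noncomputable scoped instance : NonUnitalCommRing (ChainSharp C) where
  left_distrib := mul_add'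
  right_distrib := add_mul'
  zero_mul x := by
    rw [mul_comm'']; exact map_zero (mulLeftHom x)
  mul_zero x := map_zero (mulLeftHom x)
  mul_assoc := mul_assoc'
  mul_comm := mul_comm''

/-! ### Order properties of the product -/

theorem mul_nonneg' {x y : ChainSharp C} (hx : 0 ≤ x) (hy : 0 ≤ y) : 0 ≤ x * y := by
  have h1 := int_nonneg hx
  have h2 := int_nonneg hy
  rw [mul_def']
  exact add_nonneg (add_nonneg (add_nonneg (zsmul_nonneg (pair_nonneg _) (mul_nonneg h1 h2))
    (zsmul_nonneg (pair_nonneg _) h1)) (zsmul_nonneg (pair_nonneg _) h2)) (pair_nonneg _)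

theorem mul_le_inf' {x y : ChainSharp C} (hx : 0 ≤ x) (hx' : x ≤ pair 0 (top C))
    (hy : 0 ≤ y) (hy' : y ≤ pair 0 (top C)) : x * y ≤ x ⊓ y := by
  obtain ⟨a, rfl⟩ := exists_eq_pair_zero hx hx'
  obtain ⟨b, rfl⟩ := exists_eq_pair_zero hy hy'
  rw [pair_mul_pair]
  exact le_inf (pair_mono (PMVf.mul_le_left' a b))
    (pair_mono (mul_comm a b ▸ PMVf.mul_le_left' b a))

/-- By totality the smaller of `x` and `y` is `0`. -/
theorem mul_inf_eq_zero {x y z : ChainSharp C} (h : x ⊓ y = 0) (hz : 0 ≤ z) :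
    x * z ⊓ y = 0 := by
  have hx : 0 ≤ x := h ▸ inf_le_left
  have hy : 0 ≤ y := h ▸ inf_le_right
  rcases le_total x y with hxy | hxy
  · rw [inf_eq_left.2 hxy] at h
    rw [h, zero_mul, inf_eq_left.2 hy]
  · rw [inf_eq_right.2 hxy] at h
    rw [h, inf_eq_right.2 (mul_nonneg' hx hz)]

theorem mul_le_mul' {x y z w : ChainSharp C} (hx : 0 ≤ x) (hw : 0 ≤ w) (h : x ≤ y)
    (h' : z ≤ w) : x * z ≤ y * w := by
  have h1 : 0 ≤ x * (w - z) := mul_nonneg' hx (sub_nonneg.2 h')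
  have h2 : 0 ≤ (y - x) * w := mul_nonneg' (sub_nonneg.2 h) hw
  rw [mul_sub, sub_nonneg] at h1
  rw [sub_mul, sub_nonneg] at h2
  exact h1.trans h2

theorem abs_mul' (x y : ChainSharp C) : |x * y| = |x| * |y| := by
  rcases abs_cases x with ⟨hx, h⟩ | ⟨hx, h⟩ <;> rcases abs_cases y with ⟨hy, k⟩ | ⟨hy, k⟩ <;>
    rw [hx, hy]
  · exact abs_of_nonneg (mul_nonneg' h k)
  · rw [← abs_neg, ← mul_neg]
    exact abs_of_nonneg (mul_nonneg' h (neg_nonneg.2 k.le))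
  · rw [← abs_neg, ← neg_mul]
    exact abs_of_nonneg (mul_nonneg' (neg_nonneg.2 h.le) k)
  · rw [← neg_mul_neg]
    exact abs_of_nonneg (mul_nonneg' (neg_nonneg.2 h.le) (neg_nonneg.2 k.le))

/-- `(mu)(nu) = mn u²` and `u² ≤ u`. -/
theorem abs_mul_le {x y : ChainSharp C} {m n : ℕ} (hx : |x| ≤ m • pair 0 (top C))
    (hy : |y| ≤ n • pair 0 (top C)) : |x * y| ≤ (m * n) • pair 0 (top C) := by
  have hu : (0 : ChainSharp C) ≤ pair 0 (top C) := pair_nonneg _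
  rw [abs_mul']
  refine (mul_le_mul' (abs_nonneg x) (nsmul_nonneg hu n) hx hy).trans ?_
  rw [smul_mul_smul_comm]
  refine nsmul_le_nsmul_right ?_ _
  rw [pair_mul_pair]
  exact pair_mono (le_top' _)

end ChainSharp

/-- By prelinearity `(a ⊖ b) ∧ (b ⊖ a) = 0 ∈ P`, so primeness puts one of the differences in `P`. -/
instance {A : Type*} [PMVf A] (P : MVSpec A) : IsMVChain P.toMVIdeal.Quo where
  total := by
    have key : ∀ a b : A, MVAlgebra.tsub a b ∈ P.carrier →
        MVAlgebra.Le (P.cls a) (P.cls b) := by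
      intro a b h
      refine Quotient.sound (s := P.setoid) ((P.rel_iff _ _).2 ?_)
      exact ⟨by rwa [MVAlgebra.tsub_zero'],
        P.down (MVAlgebra.tsub_le_self' _ _) P.zero_mem⟩
    rintro ⟨a⟩ ⟨b⟩
    have h := P.prime (MVAlgebra.tsub a b) (MVAlgebra.tsub b a)
      (by rw [MVAlgebra.inf_tsub_tsub]; exact P.zero_mem)
    exact h.imp (key a b) (key b a)

/-! ### Bounds uniform over the spectrum -/

namespace SharpGen

open MVAlgebra
open scoped ChainSharp

variable {A : Type*} [PMVf A]

theorem exists_abs_le {x : SharpProd A} (hx : SharpGen x) :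
    ∃ n : ℕ, ∀ P, |x P| ≤ n • ChainSharp.pair 0 (top P.toMVIdeal.Quo) := by
  have hu : ∀ P : MVSpec A, 0 ≤ ChainSharp.pair 0 (top P.toMVIdeal.Quo) :=
    fun P => ChainSharp.pair_nonneg _
  have hmono : ∀ (P : MVSpec A) {m n : ℕ}, m ≤ n →
      m • ChainSharp.pair 0 (top P.toMVIdeal.Quo) ≤ n • ChainSharp.pair 0 (top P.toMVIdeal.Quo) :=
    fun P _ _ h => nsmul_le_nsmul_left (hu P) h
  induction hx with
  | hat a =>
    refine ⟨1, fun P => ?_⟩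
    rw [one_smul, sharpHat, abs_of_nonneg (ChainSharp.pair_nonneg _)]
    exact ChainSharp.pair_mono (le_top' _)
  | zero => exact ⟨0, fun P => by rw [zero_smul, Pi.zero_apply, abs_zero]⟩
  | add _ _ hx hy =>
    obtain ⟨m, hm⟩ := hx
    obtain ⟨n, hn⟩ := hy
    refine ⟨m + n, fun P => ?_⟩
    rw [add_smul]
    exact (abs_add_le _ _).trans (add_le_add (hm P) (hn P))
  | neg _ hx =>
    obtain ⟨m, hm⟩ := hx
    exact ⟨m, fun P => (abs_neg _).trans_le (hm P)⟩
  | mul _ _ hx hy =>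
    obtain ⟨m, hm⟩ := hx
    obtain ⟨n, hn⟩ := hy
    exact ⟨m * n, fun P => ChainSharp.abs_mul_le (hm P) (hn P)⟩
  | @sup x y _ _ hx hy =>
    obtain ⟨m, hm⟩ := hx
    obtain ⟨n, hn⟩ := hy
    refine ⟨max m n, fun P => ?_⟩
    have h : |x P ⊔ y P| ≤ |x P| ⊔ |y P| := abs_max_le_max_abs_abs
    exact h.trans (max_le ((hm P).trans (hmono P (le_max_left m n)))
      ((hn P).trans (hmono P (le_max_right m n))))
  | @inf x y _ _ hx hy =>
    obtain ⟨m, hm⟩ := hx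
    obtain ⟨n, hn⟩ := hy
    refine ⟨max m n, fun P => ?_⟩
    have h : |x P ⊓ y P| ≤ |x P| ⊔ |y P| := abs_min_le_max_abs_abs
    exact h.trans (max_le ((hm P).trans (hmono P (le_max_left m n)))
      ((hn P).trans (hmono P (le_max_right m n))))

end SharpGen

/-! ### The ring `A^♯` inside the product -/

namespace Sharp

open scoped ChainSharp

variable {A : Type*} [PMVf A]

theorem val_injective : Function.Injective (Sharp.val (A := A)) := by
  rintro ⟨x, hx⟩ ⟨y, hy⟩ h
  cases h; rfl

noncomputable scoped instance : Zero (Sharp A) := ⟨⟨0, .zero⟩⟩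

noncomputable scoped instance : Add (Sharp A) := ⟨fun x y => ⟨x.val + y.val, .add x.gen y.gen⟩⟩

noncomputable scoped instance : Neg (Sharp A) := ⟨fun x => ⟨-x.val, .neg x.gen⟩⟩

noncomputable scoped instance : Mul (Sharp A) := ⟨fun x y => ⟨x.val * y.val, .mul x.gen y.gen⟩⟩

noncomputable scoped instance nonUnitalCommRing : NonUnitalCommRing (Sharp A) where
  nsmul := nsmulRec
  zsmul := zsmulRec nsmulRec
  add_assoc x y z := val_injective (add_assoc x.val y.val z.val)
  zero_add x := val_injective (zero_add x.val)
  add_zero x := val_injective (add_zero x.val)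
  add_comm x y := val_injective (add_comm x.val y.val)
  neg_add_cancel x := val_injective (neg_add_cancel x.val)
  left_distrib x y z := val_injective (mul_add x.val y.val z.val)
  right_distrib x y z := val_injective (add_mul x.val y.val z.val)
  zero_mul x := val_injective (zero_mul x.val)
  mul_zero x := val_injective (mul_zero x.val)
  mul_assoc x y z := val_injective (mul_assoc x.val y.val z.val)
  mul_comm x y := val_injective (mul_comm x.val y.val)

noncomputable scoped instance lattice : Lattice (Sharp A) where
  le x y := x.val ≤ y.val
  le_refl x := le_refl x.val
  le_trans _ _ _ h h' := le_trans h h'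
  le_antisymm _ _ h h' := val_injective (le_antisymm h h')
  sup x y := ⟨x.val ⊔ y.val, .sup x.gen y.gen⟩
  inf x y := ⟨x.val ⊓ y.val, .inf x.gen y.gen⟩
  le_sup_left x y := le_sup_left (a := x.val)
  le_sup_right x y := le_sup_right (a := x.val)
  sup_le _ _ _ h h' := sup_le (α := SharpProd A) h h'
  inf_le_left x y := inf_le_left (a := x.val)
  inf_le_right x y := inf_le_right (a := x.val)
  le_inf _ _ _ h h' := le_inf (α := SharpProd A) h h'

theorem val_nsmul (n : ℕ) (x : Sharp A) : (n • x).val = n • x.val := by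
  induction n with
  | zero => rw [zero_smul, zero_smul]; rfl
  | succ n ih => rw [succ_nsmul, succ_nsmul, ← ih]; rfl

theorem isLRing : IsLRing (Sharp A) where
  add_le_add_left _ _ z h := fun P => ChainSharp.add_le_add_left' _ _ (z.val P) (h P)
  mul_nonneg _ _ hx hy := fun P => ChainSharp.mul_nonneg' (hx P) (hy P)

theorem isStrongUnit : IsStrongUnit (Sharp.unit A) where
  nonneg := fun _ => ChainSharp.pair_nonneg _
  bound x := by
    obtain ⟨n, hn⟩ := x.gen.exists_abs_le
    refine ⟨n, ?_⟩
    change |x|.val ≤ (n • unit A).val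
    rw [val_nsmul]
    -- `|x|` is `x ⊔ -x`, hence is computed coordinatewise.
    exact hn

theorem isFRing : IsFRing (Sharp A) where
  lring := isLRing
  disjoint a b c h hc := by
    have h1 : ∀ P, a.val P ⊓ b.val P = 0 := fun P => congrFun (congrArg Sharp.val h) P
    constructor
    · exact val_injective (funext fun P => ChainSharp.mul_inf_eq_zero (h1 P) (hc P))
    · refine val_injective (funext fun P => ?_)
      change a.val P ⊓ c.val P * b.val P = 0
      rw [inf_comm, mul_comm]
      exact ChainSharp.mul_inf_eq_zero (by rw [inf_comm]; exact h1 P) (hc P)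

theorem isSemiLowFuRing : IsSemiLowFuRing (Sharp A) (Sharp.unit A) where
  semiLow :=
    { lring := isLRing
      strongUnit := isStrongUnit
      semiLow := fun _ _ ha hb P =>
        ChainSharp.mul_le_inf' (ha.1 P) (ha.2 P) (hb.1 P) (hb.2 P) }
  fring := isFRing

end Sharp

/-- The operations and order that `A^♯` inherits from the product of the `(A / P)^♯` make it a
commutative ring and a lattice, and with these it is a semi-low `f`-ring with strong unit `u`. -/
theorem mainTheorem6 (A : Type*) [PMVf A] :
    ∃ (_ : NonUnitalCommRing (Sharp A)) (_ : Lattice (Sharp A)),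
      (0 : Sharp A).val = 0 ∧
      (∀ x y : Sharp A, (x + y).val = x.val + y.val) ∧
      (∀ x : Sharp A, (-x).val = -x.val) ∧
      (∀ x y : Sharp A, (x * y).val = x.val * y.val) ∧
      (∀ x y : Sharp A, x ≤ y ↔ x.val ≤ y.val) ∧
      (∀ x y : Sharp A, (x ⊔ y).val = x.val ⊔ y.val) ∧
      (∀ x y : Sharp A, (x ⊓ y).val = x.val ⊓ y.val) ∧
      IsSemiLowFuRing (Sharp A) (Sharp.unit A) :=
  ⟨Sharp.nonUnitalCommRing, Sharp.lattice, rfl, fun _ _ => rfl, fun _ => rfl, fun _ _ => rfl,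
    fun _ _ => Iff.rfl, fun _ _ => rfl, fun _ _ => rfl, Sharp.isSemiLowFuRing⟩
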